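/- Let $p$ be a prime number and let $k$ be a positive integer. For each positive integer $n$, let $$A(n) = \sum \binom{n}{x_1, x_2, \ldots, x_{kp}}$$ be the sum of all $kp$-nomial coefficients $\binom{n}{x_1, \ldots, x_{kp}} = \frac{n!}{x_1! \cdots x_{kp}!}$ with $n$ at the top which are not divisible by $p$; here $(x_1, \ldots, x_{kp})$ ranges over the ordered tuples of nonnegative integers with $x_1 + \cdots + x_{kp} = n$ for which the coefficient is not divisible by $p$. Let $s^\star_p(n)$ be the number of nonzero digits in the expansion of $n$ to base $p$, and let $\nu_p(m)$ be the exponent of $p$ in the positive integer $m$. Then, for all positive integers $n$, $$\nu_p(A(n)) \ge s^\star_p(n) + \nu_p(k).$$ Furthermore, there exists a deterministic finite automaton $\mathcal{F}$ over the alphabet $\{0, 1, \ldots, p - 1\}$, depending only on $p$ and $k$, such that, for all positive integers $n$, equality is attained if and only if $\mathcal{F}$ accepts the expansion of $n$ to base $p$ (without leading zeroes, read from right to left, i.e., beginning with the least significant digit). -/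

import Mathlib

/-- The sum of all `m`-nomial coefficients `n! / (x₁! x₂! ⋯ xₘ!)` with `n` at the top which are not
divisible by `p`; the sum runs over all ordered `m`-tuples `x` of nonnegative integers with
`x₁ + x₂ + ⋯ + xₘ = n`. -/
def sumMultinomialNotDvd (p m n : ℕ) : ℕ :=
  ∑ x ∈ (Finset.piAntidiag (Finset.univ : Finset (Fin m)) n).filter
      (fun x => ¬ p ∣ Nat.multinomial Finset.univ x),
    Nat.multinomial Finset.univ x

/-- The number of nonzero digits in the expansion of `n` to base `p`. -/
def nonzeroDigitCount (p n : ℕ) : ℕ :=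
  ((Nat.digits p n).filter (fun d => d ≠ 0)).length

/-- The expansion of `n` to base `p` (without leading zeroes) as a word over the alphabet `Fin p`
of digits. The first letter is the least significant digit, so that an automaton which is fed this
word goes through the usual written expansion from right to left. -/
def expansionWord (p : ℕ) (hp : 1 < p) (n : ℕ) : List (Fin p) :=
  (Nat.digits p n).pmap (fun d hd => (⟨d, hd⟩ : Fin p)) (fun _ hd => Nat.digits_lt_base hp hd)

/-! Work in `ℤ_[p]` with kp variables. A multinomial coefficient is prime to p exactly when the
addition has no carries, and then removing the lowest digits divides it by a unit, `digitFactor`.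
For sums with a weight g this gives the recursion `weightedSum_eq`: n becomes n / p, and g becomes
the sum of `digitFactor * g` over the lowest digits.

The weights used are symmetric and respect congruences modulo every p ^ r when the sum of the
arguments is fixed. For a nonzero digit, symmetry and p ∣ kp make the digit sum divisible by p; the
substitution a + p * y gains a power of p, so the quotient by p is again such a weight. At the
leading digit the remaining arguments are 0 and symmetry is exact, which yields p ^ (v + 1) with v =
ν_p(k). This is the lower bound `pow_dvd_weightedSum`.

For equality, expand one step further. With weight 1 and digit d ≠ 0, the digit sum is p * (α + b *
∑ y j) modulo p ^ 2, where ∑ y j = n / p. So, modulo the first power of p beyond the bound, A(n) is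
p * (α + b * e) * A(n / p), with e the second lowest digit; for d = 0 it is A(n / p). Attainment is
thus a condition on pairs of consecutive digits and on the leading digit, which a finite automaton
checks. -/

noncomputable section

open Finset

variable (p : ℕ) [Fact p.Prime]

/-! ### The prime-to-p part of factorials -/

open Classical in
/-- The natural number `u` as a `p`-adic unit if it is prime to `p`, and `1` otherwise. -/
def unitPart (u : ℕ) : ℤ_[p]ˣ := if h : IsUnit (u : ℤ_[p]) then h.unit else 1

/-- The product of the positive integers up to `n` which are prime to `p`. -/
def unitFactorial (n : ℕ) : ℤ_[p]ˣ := ∏ u ∈ range n, unitPart p (u + 1)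

theorem isUnit_natCast_padicInt_iff (u : ℕ) : IsUnit (u : ℤ_[p]) ↔ ¬ p ∣ u := by
  rw [PadicInt.isUnit_iff, ← not_iff_not, not_not, ← PadicInt.norm_natCast_lt_one_iff]
  have := PadicInt.norm_le_one (u : ℤ_[p])
  constructor
  · intro h; exact lt_of_le_of_ne this h
  · intro h; exact h.ne

variable {p}

theorem unitPart_of_dvd {u : ℕ} (h : p ∣ u) : unitPart p u = 1 := by
  rw [unitPart, dif_neg]
  rw [isUnit_natCast_padicInt_iff]; exact not_not.2 h

theorem coe_unitPart {u : ℕ} (h : ¬ p ∣ u) : (unitPart p u : ℤ_[p]) = u := by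
  rw [unitPart, dif_pos ((isUnit_natCast_padicInt_iff p u).2 h)]; rfl

/-- The multiples of p up to n are p, 2p, …, (n / p)p; taking p out of each leaves (n / p)!. -/
theorem natCast_factorial_eq (n : ℕ) :
    (n.factorial : ℤ_[p]) = unitFactorial p n * p ^ (n / p) * (n / p).factorial := by
  induction n with
  | zero => simp [unitFactorial]
  | succ n ih =>
    rw [Nat.factorial_succ, unitFactorial, prod_range_succ, ← unitFactorial, Nat.succ_div]
    push_cast
    rw [ih]
    split_ifs with h
    · rw [unitPart_of_dvd h, Nat.factorial_succ]
      have e : ((n : ℤ_[p]) + 1) = p * ((n / p : ℕ) + 1) := by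
        have : n + 1 = p * (n / p + 1) := by
          have h2 : (n + 1) / p = _ := Nat.succ_div
          rw [if_pos h] at h2
          rw [← h2, Nat.mul_div_cancel' h]
        exact_mod_cast congrArg (Nat.cast : ℕ → ℤ_[p]) this
      rw [e]; push_cast; ring
    · rw [coe_unitPart h, add_zero]; push_cast; ring

theorem toZModPow_eq_iff (r : ℕ) (a b : ℤ_[p]) :
    PadicInt.toZModPow r a = PadicInt.toZModPow r b ↔ (p : ℤ_[p]) ^ r ∣ a - b := by
  rw [← Ideal.mem_span_singleton, ← PadicInt.ker_toZModPow, RingHom.sub_mem_ker_iff]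

/-- Reduction of `p`-adic units modulo `p ^ r`. -/
def unitRed (p : ℕ) [Fact p.Prime] (r : ℕ) : ℤ_[p]ˣ →* (ZMod (p ^ r))ˣ :=
  Units.map (PadicInt.toZModPow r : ℤ_[p] →+* ZMod (p ^ r)).toMonoidHom

theorem unitRed_eq_iff (r : ℕ) (a b : ℤ_[p]ˣ) :
    unitRed p r a = unitRed p r b ↔ (p : ℤ_[p]) ^ r ∣ (a : ℤ_[p]) - b := by
  rw [← toZModPow_eq_iff, Units.ext_iff]; rfl

theorem unitRed_unitPart_add (r u : ℕ) :
    unitRed p r (unitPart p (u + p ^ r)) = unitRed p r (unitPart p u) := by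
  rw [unitRed_eq_iff]
  rcases Nat.eq_zero_or_pos r with rfl | hr
  · simp
  have hd : p ∣ u + p ^ r ↔ p ∣ u := (Nat.dvd_add_left (dvd_pow_self p hr.ne'))
  by_cases h : p ∣ u
  · rw [unitPart_of_dvd h, unitPart_of_dvd (hd.2 h)]; simp
  · rw [coe_unitPart h, coe_unitPart (fun h' => h (hd.1 h'))]; simp

theorem prod_range_periodic {M : Type*} [CommGroup M] (c : ℕ → M) (q : ℕ)
    (hc : ∀ u, c (u + q) = c u) (x : ℕ) :
    ∏ v ∈ range q, c (x + v) = ∏ v ∈ range q, c v := by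
  induction x with
  | zero => simp
  | succ x ih =>
    rw [← ih]
    have h := prod_range_succ (fun v => c (x + v)) q
    rw [prod_range_succ', hc] at h
    have h' := mul_right_cancel h
    rw [← h']
    exact prod_congr rfl fun v _ => by rw [add_right_comm, add_assoc]

/-- By periodicity, every block of p ^ r consecutive factors has the same product. Its value
(Wilson) is never needed, because these powers cancel in `digitFactor`. -/
theorem unitRed_unitFactorial_add_mul (r x y : ℕ) :
    unitRed p r (unitFactorial p (x + p ^ r * y)) =
      unitRed p r (unitFactorial p x) * unitRed p r (unitFactorial p (p ^ r)) ^ y := by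
  induction y with
  | zero => simp
  | succ y ih =>
    rw [pow_succ, ← mul_assoc, ← ih, mul_add, mul_one, ← add_assoc]
    simp only [unitFactorial, map_prod]
    rw [prod_range_add]
    congr 1
    rw [← prod_range_periodic (fun v => unitRed p r (unitPart p (v + 1))) (p ^ r) _
      (x + p ^ r * y)]
    intro u
    rw [add_right_comm, unitRed_unitPart_add]

/-! ### Multinomial coefficients and removal of the lowest digit -/

variable {ι : Type*} [Fintype ι] [DecidableEq ι]

/-- The `p`-adic unit by which the multinomial coefficient of `x` is multiplied when
one digit is removed without a carry. -/
def digitFactor (p : ℕ) [Fact p.Prime] (x : ι → ℕ) : ℤ_[p]ˣ :=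
  unitFactorial p (∑ j, x j) * ∏ j, (unitFactorial p (x j))⁻¹

-- The block products enter with exponent ∑ x j / p ^ r, which is determined by the residues and the
-- sum; hence the assumption of equal sums.
omit [DecidableEq ι] in
theorem unitRed_digitFactor (r : ℕ) {x y : ι → ℕ} (hs : ∑ j, x j = ∑ j, y j)
    (h : ∀ j, x j ≡ y j [MOD p ^ r]) :
    unitRed p r (digitFactor p x) = unitRed p r (digitFactor p y) := by
  have key : ∀ z : ι → ℕ, ∏ j, unitRed p r (unitFactorial p (z j)) =
      (∏ j, unitRed p r (unitFactorial p (z j % p ^ r))) *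
        unitRed p r (unitFactorial p (p ^ r)) ^ (∑ j, z j / p ^ r) := by
    intro z
    rw [← prod_pow_eq_pow_sum, ← prod_mul_distrib]
    refine prod_congr rfl fun j _ => ?_
    rw [← unitRed_unitFactorial_add_mul, Nat.mod_add_div]
  have hsum : ∑ j, x j / p ^ r = ∑ j, y j / p ^ r := by
    have e : ∀ z : ι → ℕ, ∑ j, z j = ∑ j, z j % p ^ r + p ^ r * ∑ j, z j / p ^ r := by
      intro z
      rw [mul_sum, ← sum_add_distrib]
      exact sum_congr rfl fun j _ => (Nat.mod_add_div _ _).symm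
    rw [e x, e y, sum_congr rfl fun j _ => h j] at hs
    exact Nat.eq_of_mul_eq_mul_left (pow_pos (Fact.out : p.Prime).pos r) (Nat.add_left_cancel hs)
  simp only [digitFactor, map_mul, map_prod, map_inv, prod_inv_distrib]
  rw [key x, key y, hs, hsum]
  congr 3
  exact prod_congr rfl fun j _ => by rw [h j]

omit [DecidableEq ι] in
theorem digitFactor_comp_perm (σ : Equiv.Perm ι) (x : ι → ℕ) :
    digitFactor p (x ∘ σ) = digitFactor p x := by
  simp only [digitFactor, Function.comp]
  rw [Equiv.sum_comp σ x, Equiv.prod_comp σ (fun j => (unitFactorial p (x j))⁻¹)]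

omit [DecidableEq ι] in
theorem natCast_multinomial_eq {x : ι → ℕ} (h : ∑ j, x j / p = (∑ j, x j) / p) :
    (Nat.multinomial univ x : ℤ_[p]) =
      digitFactor p x * Nat.multinomial univ (fun j => x j / p) := by
  have h1 := congrArg (Nat.cast : ℕ → ℤ_[p]) (Nat.multinomial_spec univ x)
  have h2 := congrArg (Nat.cast : ℕ → ℤ_[p]) (Nat.multinomial_spec univ (fun j => x j / p))
  push_cast at h1 h2
  rw [natCast_factorial_eq (∑ j, x j), ← h, ← h2] at h1
  simp only [natCast_factorial_eq (p := p) (x _), prod_mul_distrib, prod_pow_eq_pow_sum] at h1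
  have hp0 : (p : ℤ_[p]) ≠ 0 := by exact_mod_cast (Fact.out : p.Prime).ne_zero
  have hf : ∏ j, ((x j / p).factorial : ℤ_[p]) ≠ 0 :=
    prod_ne_zero_iff.2 fun j _ => by exact_mod_cast Nat.factorial_ne_zero _
  have hu : ((∏ j, unitFactorial p (x j) : ℤ_[p]ˣ) : ℤ_[p]) ≠ 0 := Units.ne_zero _
  refine mul_left_cancel₀ (mul_ne_zero (mul_ne_zero hu (pow_ne_zero (∑ j, x j / p) hp0)) hf) ?_
  rw [Units.coe_prod]
  refine h1.trans ?_
  have e : (digitFactor p x : ℤ_[p]) * ∏ j, (unitFactorial p (x j) : ℤ_[p]) =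
      unitFactorial p (∑ j, x j) := by
    rw [← Units.coe_prod, ← Units.val_mul, digitFactor, prod_inv_distrib, inv_mul_cancel_right]
  rw [← e]; ring

omit [DecidableEq ι] in
theorem sum_div_le (x : ι → ℕ) : ∑ j, x j / p ≤ (∑ j, x j) / p := by
  rw [Nat.le_div_iff_mul_le (Fact.out : p.Prime).pos, sum_mul]
  exact sum_le_sum fun j _ => Nat.div_mul_le_self _ _

-- A carry out of the lowest digit leaves a surplus power of p in the numerator.
omit [DecidableEq ι] in
theorem natCast_dvd_multinomial_of_lt {x : ι → ℕ} (h : ∑ j, x j / p < (∑ j, x j) / p) :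
    (p : ℤ_[p]) ∣ Nat.multinomial univ x := by
  have h1 := congrArg (Nat.cast : ℕ → ℤ_[p]) (Nat.multinomial_spec univ x)
  obtain ⟨t, ht⟩ : ∏ j, (x j / p).factorial ∣ ((∑ j, x j) / p).factorial :=
    (Nat.prod_factorial_dvd_factorial_sum _ _).trans (Nat.factorial_dvd_factorial h.le)
  obtain ⟨e, he⟩ := Nat.exists_eq_add_of_lt h
  push_cast at h1
  rw [natCast_factorial_eq (∑ j, x j), ht, he] at h1
  simp only [natCast_factorial_eq (p := p) (x _), prod_mul_distrib, prod_pow_eq_pow_sum] at h1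
  push_cast at h1
  have hp0 : (p : ℤ_[p]) ≠ 0 := by exact_mod_cast (Fact.out : p.Prime).ne_zero
  have hf : ∏ j, ((x j / p).factorial : ℤ_[p]) ≠ 0 :=
    prod_ne_zero_iff.2 fun j _ => by exact_mod_cast Nat.factorial_ne_zero _
  rw [← Units.coe_prod] at h1
  have h2 : ((∏ j, unitFactorial p (x j) : ℤ_[p]ˣ) : ℤ_[p]) * Nat.multinomial univ x =
      p * (unitFactorial p (∑ j, x j) * p ^ e * t) := by
    refine mul_left_cancel₀ (mul_ne_zero (pow_ne_zero (∑ j, x j / p) hp0) hf) ?_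
    rw [pow_add, pow_add] at h1
    linear_combination h1
  exact (Units.dvd_mul_left).1 (Dvd.intro _ h2.symm)

theorem natCast_padicInt_dvd_iff (a : ℕ) : (p : ℤ_[p]) ∣ (a : ℤ_[p]) ↔ p ∣ a := by
  rw [← not_iff_not, ← isUnit_natCast_padicInt_iff, ← PadicInt.norm_lt_one_iff_dvd,
    PadicInt.isUnit_iff]
  have := PadicInt.norm_le_one (a : ℤ_[p])
  constructor
  · intro h; exact le_antisymm this (not_lt.1 h)
  · intro h; rw [h]; exact lt_irrefl _

omit [DecidableEq ι] in
theorem not_dvd_multinomial_iff (x : ι → ℕ) :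
    ¬ p ∣ Nat.multinomial univ x ↔
      ∑ j, x j / p = (∑ j, x j) / p ∧ ¬ p ∣ Nat.multinomial univ (fun j => x j / p) := by
  rcases (sum_div_le (p := p) x).lt_or_eq with h | h
  · refine ⟨fun h' => (h' ?_).elim, fun h' => (h.ne h'.1).elim⟩
    rw [← natCast_padicInt_dvd_iff]; exact natCast_dvd_multinomial_of_lt h
  · rw [← natCast_padicInt_dvd_iff, natCast_multinomial_eq h, Units.dvd_mul_left,
      natCast_padicInt_dvd_iff]
    exact ⟨fun h' => ⟨h, h'⟩, fun h' => h'.2⟩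

/-! ### Weighted sums and the digit recursion -/

/-- The sum of `g`, weighted by the multinomial coefficients with `n` at the top which are not
divisible by `p`. -/
def weightedSum (n : ℕ) (g : (ι → ℕ) → ℤ_[p]) : ℤ_[p] :=
  ∑ x ∈ (piAntidiag (univ : Finset ι) n).filter (fun x => ¬ p ∣ Nat.multinomial univ x),
    Nat.multinomial univ x * g x

/-- The result of summing `g` over the lowest digits of its arguments. -/
def digitSum (d : ℕ) (g : (ι → ℕ) → ℤ_[p]) (y : ι → ℕ) : ℤ_[p] :=
  ∑ a ∈ piAntidiag (univ : Finset ι) d, g (fun j => a j + p * y j)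

theorem le_of_mem_piAntidiag_univ {d : ℕ} {a : ι → ℕ} (ha : a ∈ piAntidiag univ d) (j : ι) :
    a j ≤ d := by
  rw [mem_piAntidiag] at ha
  rw [← ha.1]; exact single_le_sum (f := a) (fun _ _ => Nat.zero_le _) (mem_univ j)

/-- Division with remainder in each coordinate is a bijection: without a carry, the remainders sum
to n % p and the quotients to n / p. -/
theorem weightedSum_eq (n : ℕ) (g : (ι → ℕ) → ℤ_[p]) :
    weightedSum n g =
      weightedSum (n / p) (digitSum (n % p) ((fun x => (digitFactor p x : ℤ_[p])) * g)) := by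
  have hp := (Fact.out : p.Prime).pos
  simp only [weightedSum, digitSum, mul_sum, Pi.mul_apply]
  rw [← sum_product']
  refine sum_bij' (fun x _ => (fun j => x j / p, fun j => x j % p))
    (fun z _ j => z.2 j + p * z.1 j) ?_ ?_ ?_ ?_ ?_
  · intro x hx
    simp only [mem_filter, mem_piAntidiag, mem_product, mem_univ, implies_true, and_true] at hx ⊢
    obtain ⟨rfl, h⟩ := hx
    rw [not_dvd_multinomial_iff] at h
    refine ⟨h, ?_⟩
    have e : ∑ j, x j = ∑ j, x j % p + p * ∑ j, x j / p := by
      rw [mul_sum, ← sum_add_distrib]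
      exact sum_congr rfl fun j _ => (Nat.mod_add_div _ _).symm
    rw [h.1] at e
    have := Nat.mod_add_div (∑ j, x j) p
    change ∑ j, x j % p = (∑ j, x j) % p
    omega
  · rintro ⟨y, a⟩ hz
    rw [mem_product] at hz
    obtain ⟨h1, h2⟩ := hz
    have hlt : ∀ j, a j < p := fun j =>
      (le_of_mem_piAntidiag_univ h2 j).trans_lt (Nat.mod_lt _ hp)
    simp only [mem_filter, mem_piAntidiag, mem_univ, implies_true, and_true] at h1 h2 ⊢
    have hdiv : ∀ j, (a j + p * y j) / p = y j := fun j => by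
      rw [Nat.add_mul_div_left _ _ hp, Nat.div_eq_of_lt (hlt j), zero_add]
    have hs : ∑ j, (a j + p * y j) = n := by
      rw [sum_add_distrib, ← mul_sum, h1.1, h2, Nat.mod_add_div]
    refine ⟨hs, ?_⟩
    rw [not_dvd_multinomial_iff]
    simp only [hdiv, hs]
    exact h1
  · intro x hx
    funext j
    exact Nat.mod_add_div _ _
  · rintro ⟨y, a⟩ hz
    rw [mem_product] at hz
    have hlt : ∀ j, a j < p := fun j =>
      (le_of_mem_piAntidiag_univ hz.2 j).trans_lt (Nat.mod_lt _ hp)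
    simp only [Prod.mk.injEq]
    constructor <;> funext j
    · rw [Nat.add_mul_div_left _ _ hp, Nat.div_eq_of_lt (hlt j), zero_add]
    · rw [Nat.add_mul_mod_self_left, Nat.mod_eq_of_lt (hlt j)]
  · intro x hx
    simp only [mem_filter, mem_piAntidiag, mem_univ, implies_true, and_true] at hx
    obtain ⟨rfl, h⟩ := hx
    simp only [Nat.mod_add_div]
    rw [natCast_multinomial_eq ((not_dvd_multinomial_iff x).1 h).1]
    ring

theorem weightedSum_zero (g : (ι → ℕ) → ℤ_[p]) : weightedSum 0 g = g 0 := by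
  have h : (piAntidiag (univ : Finset ι) 0).filter (fun x => ¬ p ∣ Nat.multinomial univ x) = {0} := by
    rw [piAntidiag_zero, filter_singleton, if_pos]
    simp [Nat.multinomial, (Fact.out : p.Prime).one_lt.ne']
  rw [weightedSum, h, sum_singleton]
  simp [Nat.multinomial]

theorem weightedSum_congr (n : ℕ) {g h : (ι → ℕ) → ℤ_[p]}
    (H : ∀ x, ∑ j, x j = n → g x = h x) : weightedSum n g = weightedSum n h := by
  refine sum_congr rfl fun x hx => ?_
  rw [mem_filter, mem_piAntidiag] at hx
  rw [H x hx.1.1]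

theorem weightedSum_add (n : ℕ) (g h : (ι → ℕ) → ℤ_[p]) :
    weightedSum n (g + h) = weightedSum n g + weightedSum n h := by
  simp only [weightedSum, Pi.add_apply, mul_add, sum_add_distrib]

theorem weightedSum_const_mul (n : ℕ) (c : ℤ_[p]) (g : (ι → ℕ) → ℤ_[p]) :
    weightedSum n (fun x => c * g x) = c * weightedSum n g := by
  simp only [weightedSum, mul_sum]
  exact sum_congr rfl fun x _ => by ring

/-- A sum over the solutions of `∑ j, a j = d` of a function that is symmetric modulo `q` is
divisible by `q`, if `q` divides the number of variables and `d` is prime to `p`. -/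
theorem dvd_sum_piAntidiag [Nonempty ι] {q : ℤ_[p]} (hq : q ∣ (Fintype.card ι : ℤ_[p])) {d : ℕ}
    (hd : ¬ p ∣ d) (φ : (ι → ℕ) → ℤ_[p]) (hφ : ∀ (σ : Equiv.Perm ι) a, q ∣ φ (a ∘ σ) - φ a) :
    q ∣ ∑ a ∈ piAntidiag univ d, φ a := by
  obtain ⟨i⟩ := ‹Nonempty ι›
  -- Writing d as ∑ a j gives one sum per variable; by symmetry these agree modulo q, so their total
  -- is divisible by q, and d is a unit.
  have h1 : (d : ℤ_[p]) * ∑ a ∈ piAntidiag univ d, φ a =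
      ∑ j, ∑ a ∈ piAntidiag univ d, (a j : ℤ_[p]) * φ a := by
    rw [sum_comm, mul_sum]
    refine sum_congr rfl fun a ha => ?_
    rw [mem_piAntidiag] at ha
    rw [← sum_mul, ← ha.1]; push_cast; rfl
  have h2 : ∀ j, q ∣ ∑ a ∈ piAntidiag univ d, (a j : ℤ_[p]) * φ a -
      ∑ a ∈ piAntidiag univ d, (a i : ℤ_[p]) * φ a := by
    intro j
    have e : ∑ a ∈ piAntidiag univ d, (a j : ℤ_[p]) * φ a =
        ∑ a ∈ piAntidiag univ d, (a i : ℤ_[p]) * φ (a ∘ Equiv.swap i j) := by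
      refine sum_bij' (fun a _ => a ∘ Equiv.swap i j) (fun a _ => a ∘ Equiv.swap i j)
        ?_ ?_ ?_ ?_ ?_
      · intro a ha
        simp only [mem_piAntidiag, mem_univ, implies_true, and_true, Function.comp] at ha ⊢
        rw [Equiv.sum_comp (Equiv.swap i j) a, ha]
      · intro a ha
        simp only [mem_piAntidiag, mem_univ, implies_true, and_true, Function.comp] at ha ⊢
        rw [Equiv.sum_comp (Equiv.swap i j) a, ha]
      · intro a _; funext l; simp
      · intro a _; funext l; simp
      · intro a _
        have : (a ∘ Equiv.swap i j) ∘ Equiv.swap i j = a := by funext l; simp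
        rw [this]; simp
    rw [e, ← sum_sub_distrib]
    refine dvd_sum fun a _ => ?_
    rw [← mul_sub]
    exact Dvd.dvd.mul_left (hφ _ _) _
  have h3 : q ∣ (d : ℤ_[p]) * ∑ a ∈ piAntidiag univ d, φ a := by
    have h4 := dvd_sum fun j (_ : j ∈ (univ : Finset ι)) => h2 j
    rw [sum_sub_distrib, ← h1, sum_const, card_univ, nsmul_eq_mul] at h4
    exact (dvd_sub_left (hq.mul_right _)).1 h4
  exact (((isUnit_natCast_padicInt_iff p d).2 hd).dvd_mul_left).1 h3

/-! ### Rings of weights -/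

/-- Functions whose residue modulo `p ^ r` depends on the arguments modulo `p ^ r`, as long as
their sum is kept. -/
def lipschitzSubring (p : ℕ) [Fact p.Prime] (ι : Type*) [Fintype ι] :
    Subring ((ι → ℕ) → ℤ_[p]) where
  carrier := {g | ∀ (r : ℕ) (x y : ι → ℕ), ∑ j, x j = ∑ j, y j → (∀ j, x j ≡ y j [MOD p ^ r]) →
    (p : ℤ_[p]) ^ r ∣ g x - g y}
  mul_mem' := by
    intro g h hg hh r x y hs hxy
    have : (g * h) x - (g * h) y = g x * (h x - h y) + (g x - g y) * h y := by
      simp only [Pi.mul_apply]; ring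
    rw [this]
    exact dvd_add ((hh r x y hs hxy).mul_left _) ((hg r x y hs hxy).mul_right _)
  one_mem' := by intro r x y _ _; simp
  add_mem' := by
    intro g h hg hh r x y hs hxy
    have : (g + h) x - (g + h) y = (g x - g y) + (h x - h y) := by
      simp only [Pi.add_apply]; ring
    rw [this]
    exact dvd_add (hg r x y hs hxy) (hh r x y hs hxy)
  zero_mem' := by intro r x y _ _; simp
  neg_mem' := by
    intro g hg r x y hs hxy
    have : (-g) x - (-g) y = -(g x - g y) := by
      simp only [Pi.neg_apply]; ring
    rw [this]
    exact (hg r x y hs hxy).neg_right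

/-- Functions that are invariant under permutations of the arguments. -/
def symmetricSubring (p : ℕ) [Fact p.Prime] (ι : Type*) : Subring ((ι → ℕ) → ℤ_[p]) where
  carrier := {g | ∀ (σ : Equiv.Perm ι) (x : ι → ℕ), g (x ∘ σ) = g x}
  mul_mem' := by
    intro g h hg hh σ x
    simp only [Pi.mul_apply, hg σ x, hh σ x]
  one_mem' := by intro σ x; rfl
  add_mem' := by
    intro g h hg hh σ x
    simp only [Pi.add_apply, hg σ x, hh σ x]
  zero_mem' := by intro σ x; rfl
  neg_mem' := by
    intro g hg σ x
    simp only [Pi.neg_apply, hg σ x]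

omit [DecidableEq ι] in
theorem natCast_mem_lipschitzSubring (j : ι) :
    (fun y : ι → ℕ => (y j : ℤ_[p])) ∈ lipschitzSubring p ι := by
  intro r x y _ hxy
  rw [← toZModPow_eq_iff, map_natCast, map_natCast, ZMod.natCast_eq_natCast_iff]
  exact hxy j

omit [DecidableEq ι] in
theorem const_mem_lipschitzSubring (c : ℤ_[p]) :
    (fun _ : ι → ℕ => c) ∈ lipschitzSubring p ι := by
  intro r x y _ _; simp

omit [DecidableEq ι] in
theorem digitFactor_mem_lipschitzSubring :
    (fun y : ι → ℕ => (digitFactor p y : ℤ_[p])) ∈ lipschitzSubring p ι := by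
  intro r x y hs hxy
  rw [← unitRed_eq_iff]
  exact unitRed_digitFactor r hs hxy

omit [DecidableEq ι] in
theorem digitFactor_mem_symmetricSubring :
    (fun y : ι → ℕ => (digitFactor p y : ℤ_[p])) ∈ symmetricSubring p ι := by
  intro σ x
  simp only [digitFactor_comp_perm]

omit [DecidableEq ι] in
theorem linearForm_mem_lipschitzSubring (β : ι → ℤ_[p]) :
    (fun y : ι → ℕ => ∑ j, β j * (y j : ℤ_[p])) ∈ lipschitzSubring p ι := by
  have : (fun y : ι → ℕ => ∑ j, β j * (y j : ℤ_[p])) =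
      ∑ j, (fun _ : ι → ℕ => β j) * (fun y : ι → ℕ => (y j : ℤ_[p])) := by
    funext y; simp [Finset.sum_apply]
  rw [this]
  exact sum_mem fun j _ => mul_mem (const_mem_lipschitzSubring _) (natCast_mem_lipschitzSubring j)

/-- Functions of the form `α + p * ∑ j, β j * (y j : ℤ_[p]) + p ^ 2 * ρ y` with `ρ` in
`lipschitzSubring p ι`. -/
def linearSubring (p : ℕ) [Fact p.Prime] (ι : Type*) [Fintype ι] :
    Subring ((ι → ℕ) → ℤ_[p]) where
  carrier := {g | ∃ (α : ℤ_[p]) (β : ι → ℤ_[p]), ∃ ρ ∈ lipschitzSubring p ι,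
    ∀ y, g y = α + p * ∑ j, β j * (y j : ℤ_[p]) + p ^ 2 * ρ y}
  mul_mem' := by
    rintro g h ⟨α, β, ρ, hρ, hg⟩ ⟨α', β', ρ', hρ', hh⟩
    refine ⟨α * α', fun j => α * β' j + α' * β j,
      (fun y => ∑ j, β j * (y j : ℤ_[p])) * (fun y => ∑ j, β' j * (y j : ℤ_[p])) +
        (fun _ => α) * ρ' + (fun _ => α') * ρ +
        (fun _ => (p : ℤ_[p])) * ((fun y => ∑ j, β j * (y j : ℤ_[p])) * ρ' +
          (fun y => ∑ j, β' j * (y j : ℤ_[p])) * ρ) + (fun _ => (p : ℤ_[p]) ^ 2) * (ρ * ρ'), ?_,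
      fun y => ?_⟩
    · have h1 := linearForm_mem_lipschitzSubring β
      have h2 := linearForm_mem_lipschitzSubring β'
      exact add_mem (add_mem (add_mem (add_mem (mul_mem h1 h2)
        (mul_mem (const_mem_lipschitzSubring _) hρ')) (mul_mem (const_mem_lipschitzSubring _) hρ))
        (mul_mem (const_mem_lipschitzSubring _) (add_mem (mul_mem h1 hρ') (mul_mem h2 hρ))))
        (mul_mem (const_mem_lipschitzSubring _) (mul_mem hρ hρ'))
    · simp only [Pi.mul_apply, Pi.add_apply, hg, hh, add_mul, sum_add_distrib, mul_assoc α,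
        mul_assoc α', ← mul_sum]
      ring
  one_mem' := ⟨1, 0, 0, zero_mem _, fun y => by simp⟩
  add_mem' := by
    rintro g h ⟨α, β, ρ, hρ, hg⟩ ⟨α', β', ρ', hρ', hh⟩
    refine ⟨α + α', β + β', ρ + ρ', add_mem hρ hρ', fun y => ?_⟩
    simp only [Pi.add_apply, hg, hh, add_mul, sum_add_distrib]; ring
  zero_mem' := ⟨0, 0, 0, zero_mem _, fun y => by simp⟩
  neg_mem' := by
    rintro g ⟨α, β, ρ, hρ, hg⟩
    refine ⟨-α, -β, -ρ, neg_mem hρ, fun y => ?_⟩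
    simp only [Pi.neg_apply, hg, neg_mul, sum_neg_distrib]; ring

/-! ### Digit sums and the lower bound -/

theorem natCast_prime_ne_zero : (p : ℤ_[p]) ≠ 0 := by
  exact_mod_cast (Fact.out : p.Prime).ne_zero

theorem digitSum_comp_perm {F : (ι → ℕ) → ℤ_[p]} (hF : F ∈ symmetricSubring p ι) (d : ℕ) :
    digitSum d F ∈ symmetricSubring p ι := by
  intro σ x
  simp only [digitSum]
  refine sum_bij' (fun a _ => a ∘ σ.symm) (fun a _ => a ∘ σ) ?_ ?_ ?_ ?_ ?_
  · intro a ha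
    simp only [mem_piAntidiag, mem_univ, implies_true, and_true, Function.comp] at ha ⊢
    rw [Equiv.sum_comp σ.symm a, ha]
  · intro a ha
    simp only [mem_piAntidiag, mem_univ, implies_true, and_true, Function.comp] at ha ⊢
    rw [Equiv.sum_comp σ a, ha]
  · intro a _; funext l; simp
  · intro a _; funext l; simp
  · intro a _
    rw [← hF σ (fun j => (a ∘ σ.symm) j + p * x j)]
    congr 1
    funext l; simp

omit [Fact p.Prime] in
theorem modEq_add_mul {r x y : ℕ} (a : ℕ) (h : x ≡ y [MOD p ^ r]) :
    a + p * x ≡ a + p * y [MOD p ^ (r + 1)] := by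
  rw [pow_succ']
  exact (h.mul_left' p).add_left a

theorem digitSum_sub_dvd {F : (ι → ℕ) → ℤ_[p]} (hF : F ∈ lipschitzSubring p ι) (d r : ℕ)
    {x y : ι → ℕ} (hs : ∑ j, x j = ∑ j, y j) (hxy : ∀ j, x j ≡ y j [MOD p ^ r]) :
    (p : ℤ_[p]) ^ (r + 1) ∣ digitSum d F x - digitSum d F y := by
  rw [digitSum, digitSum, ← sum_sub_distrib]
  refine dvd_sum fun a _ => hF _ _ _ ?_ fun j => modEq_add_mul _ (hxy j)
  rw [sum_add_distrib, sum_add_distrib, ← mul_sum, ← mul_sum, hs]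

-- The exponent r + 1, supplied by `digitSum_sub_dvd`, pays for the division by p.
omit [DecidableEq ι] in
theorem exists_eq_prime_mul {h : (ι → ℕ) → ℤ_[p]} (hd : ∀ x, (p : ℤ_[p]) ∣ h x)
    (hs : h ∈ symmetricSubring p ι)
    (hl : ∀ (r : ℕ) (x y : ι → ℕ), ∑ j, x j = ∑ j, y j → (∀ j, x j ≡ y j [MOD p ^ r]) →
      (p : ℤ_[p]) ^ (r + 1) ∣ h x - h y) :
    ∃ g ∈ lipschitzSubring p ι ⊓ symmetricSubring p ι, h = fun x => p * g x := by
  choose g hg using hd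
  refine ⟨g, ⟨fun r x y hsum hxy => ?_, fun σ x => ?_⟩, funext hg⟩
  · have := hl r x y hsum hxy
    rw [hg, hg, ← mul_sub, pow_succ'] at this
    exact (mul_dvd_mul_iff_left natCast_prime_ne_zero).1 this
  · have := hs σ x
    rw [hg, hg] at this
    exact mul_left_cancel₀ natCast_prime_ne_zero this

/-- Modulo p the term p * y is invisible, so permuting a alone is harmless. -/
theorem dvd_digitSum [Nonempty ι] {F : (ι → ℕ) → ℤ_[p]}
    (hF : F ∈ lipschitzSubring p ι ⊓ symmetricSubring p ι) {d : ℕ} (hd : ¬ p ∣ d)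
    (hι : (p : ℤ_[p]) ∣ (Fintype.card ι : ℤ_[p])) (y : ι → ℕ) : (p : ℤ_[p]) ∣ digitSum d F y := by
  refine dvd_sum_piAntidiag hι hd _ fun σ a => ?_
  rw [← hF.2 σ (fun j => a j + p * y j), ← pow_one (p : ℤ_[p])]
  refine hF.1 1 _ _ ?_ fun j => ?_
  · simp only [Function.comp, sum_add_distrib]
    rw [← mul_sum, ← mul_sum, Equiv.sum_comp σ y]
  · simp only [Function.comp, pow_one]
    exact Nat.ModEq.add_left _
      ((Nat.modEq_zero_iff_dvd.2 (dvd_mul_right _ _)).trans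
        (Nat.modEq_zero_iff_dvd.2 (dvd_mul_right _ _)).symm)

theorem dvd_digitSum_zero [Nonempty ι] {F : (ι → ℕ) → ℤ_[p]}
    (hF : F ∈ symmetricSubring p ι) {d : ℕ} (hd : ¬ p ∣ d) {q : ℤ_[p]}
    (hι : q ∣ (Fintype.card ι : ℤ_[p])) : q ∣ digitSum d F 0 := by
  refine dvd_sum_piAntidiag hι hd _ fun σ a => ?_
  have : F (fun j => (a ∘ σ) j + p * (0 : ι → ℕ) j) = F (fun j => a j + p * (0 : ι → ℕ) j) := by
    rw [← hF σ (fun j => a j + p * (0 : ι → ℕ) j)]; rfl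
  rw [this, sub_self]; exact dvd_zero _

theorem nonzeroDigitCount_eq {n : ℕ} (hn : 0 < n) :
    nonzeroDigitCount p n = nonzeroDigitCount p (n / p) + if n % p = 0 then 0 else 1 := by
  rw [nonzeroDigitCount, Nat.digits_def' (Fact.out : p.Prime).one_lt hn, List.filter_cons,
    nonzeroDigitCount]
  by_cases h : n % p = 0 <;> simp [h]

omit [DecidableEq ι] in
theorem digitFactor_mem :
    (fun y : ι → ℕ => (digitFactor p y : ℤ_[p])) ∈
      lipschitzSubring p ι ⊓ symmetricSubring p ι :=
  ⟨digitFactor_mem_lipschitzSubring, digitFactor_mem_symmetricSubring⟩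

theorem digitSum_zero_mem {F : (ι → ℕ) → ℤ_[p]}
    (hF : F ∈ lipschitzSubring p ι ⊓ symmetricSubring p ι) :
    digitSum 0 F ∈ lipschitzSubring p ι ⊓ symmetricSubring p ι :=
  ⟨fun r _ _ hs hxy => (pow_dvd_pow _ r.le_succ).trans (digitSum_sub_dvd hF.1 0 r hs hxy),
    digitSum_comp_perm hF.2 0⟩

/-- The lower bound for the divisibility of weighted sums by powers of `p`. -/
theorem pow_dvd_weightedSum [Nonempty ι] {v : ℕ}
    (hι : (p : ℤ_[p]) ^ (v + 1) ∣ (Fintype.card ι : ℤ_[p])) {n : ℕ} (hn : 0 < n)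
    {g : (ι → ℕ) → ℤ_[p]} (hg : g ∈ lipschitzSubring p ι ⊓ symmetricSubring p ι) :
    (p : ℤ_[p]) ^ (nonzeroDigitCount p n + v) ∣ weightedSum n g := by
  have hp := (Fact.out : p.Prime)
  induction n using Nat.strong_induction_on generalizing g with
  | _ n ih =>
    have hF := mul_mem digitFactor_mem hg
    rw [weightedSum_eq, nonzeroDigitCount_eq hn]
    by_cases h0 : n % p = 0
    · have hpos : 0 < n / p := Nat.div_pos (Nat.le_of_dvd hn (Nat.dvd_of_mod_eq_zero h0)) hp.pos
      rw [if_pos h0, h0]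
      exact ih _ (Nat.div_lt_self hn hp.one_lt) hpos (digitSum_zero_mem hF)
    · rw [if_neg h0]
      have hnd : ¬ p ∣ n % p := fun h => h0 (by
        rw [Nat.dvd_mod_iff dvd_rfl] at h; exact Nat.mod_eq_zero_of_dvd h)
      -- The leading digit contributes the full p ^ (v + 1); every other nonzero digit contributes
      -- one p.
      rcases Nat.eq_zero_or_pos (n / p) with hz | hpos
      · rw [hz, weightedSum_zero]
        have : nonzeroDigitCount p 0 = 0 := by simp [nonzeroDigitCount]
        rw [this, zero_add, add_comm]
        exact dvd_digitSum_zero hF.2 hnd hι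
      · obtain ⟨h, hh, he⟩ := exists_eq_prime_mul (h := digitSum (n % p) _)
          (dvd_digitSum hF hnd ((dvd_pow_self _ v.succ_ne_zero).trans hι))
          (digitSum_comp_perm hF.2 _) (fun r x y => digitSum_sub_dvd hF.1 _ r)
        rw [he, weightedSum_const_mul, add_right_comm, pow_succ']
        exact mul_dvd_mul_left _ (ih _ (Nat.div_lt_self hn hp.one_lt) hpos hh)

/-! ### Expansion of digit sums modulo p ^ 2 -/

omit [Fact p.Prime] in
theorem not_dvd_mul_add {u : ℕ} (hu : u + 1 < p) (y : ℕ) : ¬ p ∣ p * y + u + 1 := by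
  rw [add_assoc, Nat.dvd_add_right (dvd_mul_right _ _)]
  exact Nat.not_dvd_of_pos_of_lt u.succ_pos hu

omit [DecidableEq ι] in
theorem unitPart_sum_mem_linearSubring {u : ℕ} (hu : u + 1 < p) :
    (fun y : ι → ℕ => (unitPart p (p * (∑ j, y j) + u + 1) : ℤ_[p])) ∈ linearSubring p ι := by
  refine ⟨(u + 1 : ℕ), 1, 0, zero_mem _, fun y => ?_⟩
  simp only [coe_unitPart (not_dvd_mul_add hu _), Pi.one_apply, one_mul, Pi.zero_apply]
  push_cast; ring

theorem inv_unitPart_mem_linearSubring {u : ℕ} (hu : u + 1 < p) (i : ι) :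
    (fun y : ι → ℕ => (((unitPart p (p * y i + u + 1))⁻¹ : ℤ_[p]ˣ) : ℤ_[p])) ∈
      linearSubring p ι := by
  have hw : ∀ y, ((p : ℤ_[p]) * (y : ℕ) + ((u + 1 : ℕ) : ℤ_[p])) *
      (((unitPart p (p * y + u + 1))⁻¹ : ℤ_[p]ˣ) : ℤ_[p]) = 1 := fun y => by
    have := Units.mul_inv (unitPart p (p * y + u + 1))
    rw [coe_unitPart (not_dvd_mul_add hu _)] at this
    rw [← this]; push_cast; ring
  set v : ℤ_[p] := (((unitPart p (p * 0 + u + 1))⁻¹ : ℤ_[p]ˣ) : ℤ_[p])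
  have hv : ((u + 1 : ℕ) : ℤ_[p]) * v = 1 := by
    have := hw 0
    rwa [Nat.cast_zero, mul_zero, zero_add] at this
  have hl : (fun y : ι → ℕ => (((unitPart p (p * y i + u + 1))⁻¹ : ℤ_[p]ˣ) : ℤ_[p])) ∈
      lipschitzSubring p ι := by
    intro r x y _ hxy
    have h1 := hw (x i)
    have h2 := hw (y i)
    set a : ℤ_[p] := (((unitPart p (p * x i + u + 1))⁻¹ : ℤ_[p]ˣ) : ℤ_[p])
    set b : ℤ_[p] := (((unitPart p (p * y i + u + 1))⁻¹ : ℤ_[p]ˣ) : ℤ_[p])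
    have e : a - b = ((x i : ℤ_[p]) - y i) * (-(p * a * b)) := by
      linear_combination (-a) * h2 + b * h1
    change _ ∣ a - b
    rw [e]
    exact (natCast_mem_lipschitzSubring i r x y ‹_› hxy).mul_right _
  -- With c = u + 1 and v = 1/c, this is 1/(c + z) = v - v² z + v² z²/(c + z) at z = p * y i.
  refine ⟨v, fun j => if j = i then - v ^ 2 else 0,
    (fun _ => v ^ 2) * ((fun y => (y i : ℤ_[p])) * (fun y => (y i : ℤ_[p]))) *
      (fun y : ι → ℕ => (((unitPart p (p * y i + u + 1))⁻¹ : ℤ_[p]ˣ) : ℤ_[p])),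
    mul_mem (mul_mem (const_mem_lipschitzSubring _) (mul_mem (natCast_mem_lipschitzSubring i)
      (natCast_mem_lipschitzSubring i))) hl, fun y => ?_⟩
  have h1 := hw (y i)
  simp only [Pi.mul_apply, ite_mul, zero_mul, sum_ite_eq', mem_univ, if_true]
  set b : ℤ_[p] := (((unitPart p (p * y i + u + 1))⁻¹ : ℤ_[p]ˣ) : ℤ_[p])
  set c : ℤ_[p] := ((u + 1 : ℕ) : ℤ_[p])
  linear_combination (-b + p * y i * v * b) * hv + (v - p * y i * v ^ 2) * h1

/-- The ratio of the values of `digitFactor` at `a + p * y` and at `p * y`. -/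
def digitRatio (p : ℕ) [Fact p.Prime] (a y : ι → ℕ) : ℤ_[p]ˣ :=
  (∏ u ∈ range (∑ j, a j), unitPart p (p * (∑ j, y j) + u + 1)) *
    ∏ j, ∏ u ∈ range (a j), (unitPart p (p * y j + u + 1))⁻¹

theorem unitFactorial_add_mul (a y : ℕ) :
    unitFactorial p (a + p * y) =
      unitFactorial p (p * y) * ∏ u ∈ range a, unitPart p (p * y + u + 1) := by
  rw [add_comm, unitFactorial, prod_range_add]; rfl

omit [DecidableEq ι] in
theorem digitFactor_add_mul (a y : ι → ℕ) :
    digitFactor p (fun j => a j + p * y j) =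
      digitFactor p (fun j => p * y j) * digitRatio p a y := by
  simp only [digitFactor, digitRatio, sum_add_distrib, ← mul_sum, unitFactorial_add_mul,
    mul_inv, prod_mul_distrib, prod_inv_distrib]
  exact mul_mul_mul_comm _ _ _ _

theorem digitRatio_mem_linearSubring {a : ι → ℕ} (ha : ∑ j, a j < p) :
    (fun y => (digitRatio p a y : ℤ_[p])) ∈ linearSubring p ι := by
  have e : (fun y => (digitRatio p a y : ℤ_[p])) =
      (∏ u ∈ range (∑ j, a j), fun y : ι → ℕ => (unitPart p (p * (∑ j, y j) + u + 1) : ℤ_[p])) *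
        ∏ j, ∏ u ∈ range (a j),
          fun y : ι → ℕ => (((unitPart p (p * y j + u + 1))⁻¹ : ℤ_[p]ˣ) : ℤ_[p]) := by
    funext y
    simp only [digitRatio, Pi.mul_apply, Finset.prod_apply, Units.val_mul, Units.coe_prod]
  rw [e]
  refine mul_mem (prod_mem fun u hu => unitPart_sum_mem_linearSubring ?_)
    (prod_mem fun j _ => prod_mem fun u hu => inv_unitPart_mem_linearSubring ?_ j)
  · rw [mem_range] at hu; omega
  · have := single_le_sum (f := a) (fun _ _ => Nat.zero_le _) (mem_univ j)
    rw [mem_range] at hu; omega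

/-- A symmetric element of `linearSubring p ι` is, up to multiples of `p ^ 2`, an affine function
of the sum of its arguments. -/
theorem exists_eq_add_mul_sum [Nonempty ι] {B : (ι → ℕ) → ℤ_[p]} (hB : B ∈ linearSubring p ι)
    (hs : B ∈ symmetricSubring p ι) :
    ∃ b : ℤ_[p], ∃ ρ ∈ lipschitzSubring p ι ⊓ symmetricSubring p ι,
      ∀ y, B y = B 0 + p * (b * (∑ j, y j : ℕ)) + p ^ 2 * ρ y := by
  obtain ⟨α, β, ρ, hρ, hB⟩ := hB
  obtain ⟨i⟩ := ‹Nonempty ι›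
  have hp0 : (p : ℤ_[p]) ≠ 0 := natCast_prime_ne_zero
  -- Comparing values at two unit vectors shows that the linear coefficients agree modulo p.
  have hβ : ∀ j, ∃ c, β j = β i + p * c := by
    intro j
    have e : (Pi.single j 1 : ι → ℕ) = Pi.single i 1 ∘ Equiv.swap i j := by
      funext l
      rcases eq_or_ne l j with rfl | h
      · simp
      · have h' : Equiv.swap i j l ≠ i := fun h' => h (by
          exact (Equiv.swap i j).injective (h'.trans (Equiv.swap_apply_right i j).symm))
        simp [h, h']
    have h1 := hs (Equiv.swap i j) (Pi.single i 1)
    rw [← e, hB, hB] at h1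
    have hval : ∀ l, ∑ m, β m * ((Pi.single l 1 : ι → ℕ) m : ℤ_[p]) = β l := by
      intro l
      rw [sum_eq_single l]
      · simp
      · intro m _ hm; simp [hm]
      · simp
    rw [hval, hval] at h1
    refine ⟨ρ (Pi.single i 1) - ρ (Pi.single j 1), mul_left_cancel₀ hp0 ?_⟩
    linear_combination h1
  choose c hc using hβ
  have hsum : ∀ y : ι → ℕ, ∑ j, β j * (y j : ℤ_[p]) =
      β i * (∑ j, y j : ℕ) + p * ∑ j, c j * (y j : ℤ_[p]) := by
    intro y
    push_cast
    rw [mul_sum, mul_sum, ← sum_add_distrib]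
    exact sum_congr rfl fun j _ => by rw [hc j]; ring
  have h0 : B 0 = α + p ^ 2 * ρ 0 := by rw [hB]; simp
  set ρ' : (ι → ℕ) → ℤ_[p] := ρ + (fun y => ∑ j, c j * (y j : ℤ_[p])) - fun _ => ρ 0 with hρ'
  have hBy : ∀ y, B y = B 0 + p * (β i * (∑ j, y j : ℕ)) + p ^ 2 * ρ' y := by
    intro y
    rw [h0, hB, hsum, hρ']
    simp only [Pi.sub_apply, Pi.add_apply]
    ring
  refine ⟨β i, ρ', ⟨sub_mem (add_mem hρ (linearForm_mem_lipschitzSubring c))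
    (const_mem_lipschitzSubring _), fun σ x => ?_⟩, hBy⟩
  have h1 := hs σ x
  rw [hBy, hBy x] at h1
  have h2 : ∑ j, (x ∘ σ) j = ∑ j, x j := Equiv.sum_comp σ x
  rw [h2] at h1
  exact mul_left_cancel₀ (pow_ne_zero 2 hp0) (add_left_cancel h1)

omit [DecidableEq ι] in
theorem digitFactor_zero : digitFactor p (0 : ι → ℕ) = 1 := by
  simp [digitFactor, unitFactorial]

omit [DecidableEq ι] in
theorem sum_mem_lipschitz_inf_symmetric :
    (fun y : ι → ℕ => ((∑ j, y j : ℕ) : ℤ_[p])) ∈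
      lipschitzSubring p ι ⊓ symmetricSubring p ι := by
  refine ⟨fun r x y hs _ => by simp [hs], fun σ x => ?_⟩
  have h2 : ∑ j, (x ∘ σ) j = ∑ j, x j := Equiv.sum_comp σ x
  simp only [h2]

omit [DecidableEq ι] in
theorem const_mem_lipschitz_inf_symmetric (c : ℤ_[p]) :
    (fun _ : ι → ℕ => c) ∈ lipschitzSubring p ι ⊓ symmetricSubring p ι :=
  ⟨const_mem_lipschitzSubring c, fun _ _ => rfl⟩

-- Modulo p, the unit factorial of p * y is the y-th power of that of p, so numerator and
-- denominator cancel.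
omit [DecidableEq ι] in
theorem exists_digitFactor_mul_eq :
    ∃ q ∈ lipschitzSubring p ι ⊓ symmetricSubring p ι,
      ∀ y : ι → ℕ, (digitFactor p (fun j => p * y j) : ℤ_[p]) = 1 + p * q y := by
  have h1 : ∀ (r : ℕ) (x y : ι → ℕ), ∑ j, x j = ∑ j, y j → (∀ j, x j ≡ y j [MOD p ^ r]) →
      (p : ℤ_[p]) ^ (r + 1) ∣ ((digitFactor p (fun j => p * x j) : ℤ_[p]) - 1) -
        ((digitFactor p (fun j => p * y j) : ℤ_[p]) - 1) := by
    intro r x y hs hxy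
    rw [sub_sub_sub_cancel_right]
    refine digitFactor_mem.1 _ _ _ ?_ fun j => ?_
    · rw [← mul_sum, ← mul_sum, hs]
    · simpa using modEq_add_mul 0 (hxy j)
  have h2 : ∀ x : ι → ℕ, (p : ℤ_[p]) ∣ (digitFactor p (fun j => p * x j) : ℤ_[p]) - 1 := by
    intro x
    rw [← Units.val_one, ← pow_one (p : ℤ_[p]), ← unitRed_eq_iff, map_one, digitFactor]
    have h3 : ∀ y, unitRed p 1 (unitFactorial p (p * y)) =
        unitRed p 1 (unitFactorial p p) ^ y := by
      intro y
      have := unitRed_unitFactorial_add_mul (p := p) 1 0 y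
      simpa [unitFactorial] using this
    rw [← mul_sum, map_mul, map_prod, h3]
    simp only [map_inv, h3, prod_inv_distrib]
    rw [prod_pow_eq_pow_sum, mul_inv_cancel]
  obtain ⟨q, hq, he⟩ := exists_eq_prime_mul (h := fun y : ι → ℕ =>
    (digitFactor p (fun j => p * y j) : ℤ_[p]) - 1) h2
    (fun σ x => by
      have := digitFactor_comp_perm (p := p) σ (fun j => p * x j)
      exact congrArg (fun u : ℤ_[p]ˣ => (u : ℤ_[p]) - 1) this) h1
  exact ⟨q, hq, fun y => by rw [← congrFun he y]; ring⟩

/-- Up to multiples of `p ^ 2`, the sum of `digitFactor` over the lowest digits is an affine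
function of the sum of the arguments. -/
theorem exists_digitSum_digitFactor_eq [Nonempty ι]
    (hι : (p : ℤ_[p]) ∣ (Fintype.card ι : ℤ_[p])) {d : ℕ} (hd : 0 < d) (hdp : d < p) :
    ∃ α b : ℤ_[p], ∃ ρ ∈ lipschitzSubring p ι ⊓ symmetricSubring p ι,
      ∀ y : ι → ℕ, digitSum d (fun x => (digitFactor p x : ℤ_[p])) y =
        p * (α + b * (∑ j, y j : ℕ)) + p ^ 2 * ρ y := by
  have hnd := Nat.not_dvd_of_pos_of_lt hd hdp
  set B : (ι → ℕ) → ℤ_[p] := ∑ a ∈ piAntidiag univ d, fun y => (digitRatio p a y : ℤ_[p])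
    with hBdef
  have hB : ∀ y, digitSum d (fun x => (digitFactor p x : ℤ_[p])) y =
      digitFactor p (fun j => p * y j) * B y := by
    intro y
    rw [hBdef, Finset.sum_apply, mul_sum, digitSum]
    exact sum_congr rfl fun a _ => by rw [digitFactor_add_mul, Units.val_mul]
  have hBlin : B ∈ linearSubring p ι := sum_mem fun a ha => digitRatio_mem_linearSubring (by
    rw [mem_piAntidiag] at ha; rw [ha.1]; exact hdp)
  have hBsymm : B ∈ symmetricSubring p ι := by
    intro σ x
    have h1 := digitSum_comp_perm (p := p) digitFactor_mem_symmetricSubring d σ x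
    rw [hB, hB] at h1
    have h2 : digitFactor p (fun j => p * (x ∘ σ) j) = digitFactor p (fun j => p * x j) :=
      digitFactor_comp_perm σ (fun j => p * x j)
    rw [h2] at h1
    exact (Units.isUnit _).mul_left_cancel h1
  obtain ⟨b, ρ, hρ, hby⟩ := exists_eq_add_mul_sum hBlin hBsymm
  obtain ⟨q, hq, hqy⟩ := exists_digitFactor_mul_eq (p := p) (ι := ι)
  obtain ⟨α, hα⟩ : (p : ℤ_[p]) ∣ B 0 := by
    have h1 := hB 0
    have h2 : digitFactor p (fun j : ι => p * (0 : ι → ℕ) j) = 1 := by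
      rw [← digitFactor_zero (p := p) (ι := ι)]; congr 1
    rw [h2, Units.val_one, one_mul] at h1
    rw [← h1]
    exact dvd_digitSum_zero digitFactor_mem_symmetricSubring hnd hι
  -- The p ^ 2 part of (1 + p q)(p α + p b ∑ y j + p ^ 2 ρ).
  refine ⟨α, b, ρ + q * ((fun _ => α) + (fun _ => b) * fun y => ((∑ j, y j : ℕ) : ℤ_[p])) +
    (fun _ => (p : ℤ_[p])) * (q * ρ), ?_, fun y => ?_⟩
  · exact add_mem (add_mem hρ (mul_mem hq (add_mem (const_mem_lipschitz_inf_symmetric _)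
      (mul_mem (const_mem_lipschitz_inf_symmetric _) sum_mem_lipschitz_inf_symmetric))))
      (mul_mem (const_mem_lipschitz_inf_symmetric _) (mul_mem hq hρ))
  · rw [hB, hqy, hby, hα]
    simp only [Pi.add_apply, Pi.mul_apply]
    ring

/-! ### When the bound is attained -/

omit [Fintype ι] [DecidableEq ι] in
theorem prime_pow_mul_dvd_iff {e : ℕ} {S T c : ℤ_[p]} {t : ℤ_[p]} (hT : T = p ^ e * t) {f : ℕ}
    (hS : (p : ℤ_[p]) ^ (e + f + 1) ∣ S - p ^ f * c * T) :
    (p : ℤ_[p]) ^ (e + f + 1) ∣ S ↔ (p : ℤ_[p]) ∣ c ∨ (p : ℤ_[p]) ^ (e + 1) ∣ T := by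
  have hp0 : (p : ℤ_[p]) ≠ 0 := natCast_prime_ne_zero
  have e1 : (p : ℤ_[p]) ^ (e + f + 1) ∣ S ↔ (p : ℤ_[p]) ^ (e + f + 1) ∣ p ^ f * c * T :=
    dvd_iff_dvd_of_dvd_sub hS
  have e2 : (p : ℤ_[p]) ^ f * c * (p ^ e * t) = p ^ (e + f) * (c * t) := by ring
  rw [e1, hT, e2, pow_succ, pow_succ, mul_dvd_mul_iff_left (pow_ne_zero _ hp0),
    mul_dvd_mul_iff_left (pow_ne_zero _ hp0), PadicInt.prime_p.dvd_mul]

/-- Whether the lower bound is attained at `n` is determined by the two lowest digits of `n`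
and by whether it is attained at `n / p`. -/
theorem exists_pow_dvd_weightedSum_iff [Nonempty ι] {v : ℕ}
    (hι : (p : ℤ_[p]) ^ (v + 1) ∣ (Fintype.card ι : ℤ_[p])) :
    ∃ P : ℕ → ℕ → Prop, ∀ n, 0 < n / p →
      (¬ (p : ℤ_[p]) ^ (nonzeroDigitCount p n + v + 1) ∣
          weightedSum n (1 : (ι → ℕ) → ℤ_[p]) ↔
        P (n % p) (n / p % p) ∧ ¬ (p : ℤ_[p]) ^ (nonzeroDigitCount p (n / p) + v + 1) ∣
          weightedSum (n / p) (1 : (ι → ℕ) → ℤ_[p])) := by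
  have hp := (Fact.out : p.Prime)
  have H : ∀ d : ℕ, ∃ α b : ℤ_[p], 0 < d → d < p →
      ∃ ρ ∈ lipschitzSubring p ι ⊓ symmetricSubring p ι,
      ∀ y : ι → ℕ, digitSum d (fun x => (digitFactor p x : ℤ_[p])) y =
        p * (α + b * (∑ j, y j : ℕ)) + p ^ 2 * ρ y := by
    intro d
    by_cases h : 0 < d ∧ d < p
    · obtain ⟨α, b, hab⟩ := exists_digitSum_digitFactor_eq (ι := ι)
        ((dvd_pow_self _ v.succ_ne_zero).trans hι) h.1 h.2
      exact ⟨α, b, fun _ _ => hab⟩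
    · exact ⟨0, 0, fun h1 h2 => (h ⟨h1, h2⟩).elim⟩
  choose α b hab using H
  -- Only divisibility by p of the affine factor matters, so n / p may be replaced by its lowest
  -- digit e.
  refine ⟨fun d e => d = 0 ∨ ¬ (p : ℤ_[p]) ∣ α d + b d * e, fun n hn => ?_⟩
  have hn0 : 0 < n := Nat.pos_of_ne_zero fun h => by simp [h] at hn
  obtain ⟨t, ht⟩ := pow_dvd_weightedSum hι hn (one_mem (lipschitzSubring p ι ⊓ symmetricSubring p ι))
  have hF : (fun x : ι → ℕ => (digitFactor p x : ℤ_[p])) * 1 =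
    fun x : ι → ℕ => (digitFactor p x : ℤ_[p]) := mul_one _
  have hrec := weightedSum_eq n (1 : (ι → ℕ) → ℤ_[p])
  rw [hF] at hrec
  rcases Nat.eq_zero_or_pos (n % p) with h0 | hpos
  · rw [h0] at hrec
    -- For digit 0 the digit sum has the single term a = 0 and is 1 modulo p.
    obtain ⟨h, hh, he⟩ := exists_eq_prime_mul
      (h := digitSum 0 (fun x : ι → ℕ => (digitFactor p x : ℤ_[p])) - 1)
      (fun x => by
        obtain ⟨q, -, hq⟩ := exists_digitFactor_mul_eq (p := p) (ι := ι)
        refine ⟨q x, ?_⟩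
        simp [digitSum, hq])
      (sub_mem (digitSum_comp_perm digitFactor_mem.2 0) (one_mem _))
      (fun r x y hs hxy => by
        simpa using digitSum_sub_dvd digitFactor_mem.1 0 r hs hxy)
    have hdec : digitSum 0 (fun x : ι → ℕ => (digitFactor p x : ℤ_[p])) =
        1 + fun x => p * h x := by rw [← he]; ring
    rw [hdec, weightedSum_add, weightedSum_const_mul] at hrec
    have hcount : nonzeroDigitCount p n = nonzeroDigitCount p (n / p) := by
      rw [nonzeroDigitCount_eq hn0, if_pos h0, add_zero]
    have key := prime_pow_mul_dvd_iff (S := weightedSum n (1 : (ι → ℕ) → ℤ_[p])) (c := 1) ht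
      (f := 0) (by
        rw [hrec, pow_zero, one_mul, one_mul, add_sub_cancel_left, add_zero, pow_succ']
        exact mul_dvd_mul_left _ (pow_dvd_weightedSum hι hn hh))
    rw [add_zero] at key
    rw [hcount, key]
    simp [h0, PadicInt.prime_p.not_dvd_one]
  · obtain ⟨ρ, hρ, hd⟩ := hab (n % p) hpos (Nat.mod_lt _ hp.pos)
    have hcount : nonzeroDigitCount p n = nonzeroDigitCount p (n / p) + 1 := by
      rw [nonzeroDigitCount_eq hn0, if_neg hpos.ne']
    have hval : weightedSum n (1 : (ι → ℕ) → ℤ_[p]) =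
        p * (α (n % p) + b (n % p) * (n / p : ℕ)) * weightedSum (n / p) (1 : (ι → ℕ) → ℤ_[p]) +
          p ^ 2 * weightedSum (n / p) ρ := by
      rw [hrec, ← weightedSum_const_mul, ← weightedSum_const_mul, ← weightedSum_add]
      refine weightedSum_congr _ fun y hy => ?_
      rw [hd, hy]
      simp
    have key := prime_pow_mul_dvd_iff (S := weightedSum n (1 : (ι → ℕ) → ℤ_[p]))
      (c := α (n % p) + b (n % p) * (n / p : ℕ)) ht (f := 1) (by
        rw [hval, pow_one, add_sub_cancel_left, add_assoc, add_comm, pow_add]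
        exact mul_dvd_mul_left _ (pow_dvd_weightedSum hι hn hρ))
    have hc : (p : ℤ_[p]) ∣ α (n % p) + b (n % p) * (n / p : ℕ) ↔
        (p : ℤ_[p]) ∣ α (n % p) + b (n % p) * (n / p % p : ℕ) := by
      refine dvd_iff_dvd_of_dvd_sub ?_
      rw [add_sub_add_left_eq_sub, ← mul_sub]
      refine Dvd.dvd.mul_left ?_ _
      refine ⟨(n / p / p : ℕ), ?_⟩
      rw [sub_eq_iff_eq_add']
      exact_mod_cast (Nat.mod_add_div (n / p) p).symm
    rw [hcount, add_right_comm _ 1 v, key, hc, not_or]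
    simp [hpos.ne']

/-! ### The automaton -/

/-- The automaton which accepts the words whose consecutive letters are related by `R` and
whose last letter satisfies `Q`. -/
def chainDFA {α : Type} (R : α → α → Prop) (Q : α → Prop) : DFA α (Option (Option α)) where
  -- `none` is the dead state, `some none` the start, and `some (some d)` remembers the last letter
  -- d.
  step s a := open Classical in
    match s with
    | none => none
    | some none => some (some a)
    | some (some d) => if R d a then some (some a) else none
  start := some none
  accept := {s | ∃ d, s = some (some d) ∧ Q d}

theorem chainDFA_evalFrom_none {α : Type} (R : α → α → Prop) (Q : α → Prop) (l : List α) :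
    (chainDFA R Q).evalFrom none l = none := by
  induction l with
  | nil => rfl
  | cons a l ih => exact ih

theorem cons_mem_chainDFA_accepts {α : Type} (R : α → α → Prop) (Q : α → Prop) (a b : α)
    (l : List α) :
    a :: b :: l ∈ (chainDFA R Q).accepts ↔ R a b ∧ b :: l ∈ (chainDFA R Q).accepts := by
  have h1 : (chainDFA R Q).eval (b :: l) = (chainDFA R Q).evalFrom (some (some b)) l := rfl
  have h2 : (chainDFA R Q).eval (a :: b :: l) =
      (chainDFA R Q).evalFrom ((chainDFA R Q).step (some (some a)) b) l := rfl
  rw [DFA.mem_accepts, DFA.mem_accepts, h1, h2]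
  by_cases h : R a b
  · simp [chainDFA, h]
  · have : (chainDFA R Q).step (some (some a)) b = none := by simp [chainDFA, h]
    rw [this, chainDFA_evalFrom_none]
    simp [h, chainDFA]

theorem singleton_mem_chainDFA_accepts {α : Type} (R : α → α → Prop) (Q : α → Prop) (a : α) :
    [a] ∈ (chainDFA R Q).accepts ↔ Q a := by
  have h1 : (chainDFA R Q).eval [a] = some (some a) := rfl
  rw [DFA.mem_accepts, h1]
  simp [chainDFA]

theorem expansionWord_eq_cons {p : ℕ} (hp : 1 < p) {n : ℕ} (hn : 0 < n) :
    expansionWord p hp n =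
      ⟨n % p, Nat.mod_lt _ (by omega)⟩ :: expansionWord p hp (n / p) := by
  apply (List.map_injective_iff.2 Fin.val_injective)
  have h : ∀ m, (expansionWord p hp m).map Fin.val = Nat.digits p m := by
    intro m; simp [expansionWord, List.map_pmap]
  rw [h, List.map_cons, h, Nat.digits_def' hp hn]

theorem expansionWord_zero {p : ℕ} (hp : 1 < p) : expansionWord p hp 0 = [] := by
  simp [expansionWord]

/-- A property of positive integers which is inherited from `n / p` according to the two lowest
digits of `n` is recognized by an automaton. -/
theorem mem_chainDFA_accepts_iff {p : ℕ} (hp : 1 < p) (E : ℕ → Prop) (P : ℕ → ℕ → Prop)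
    (h : ∀ n, 0 < n / p → (E n ↔ P (n % p) (n / p % p) ∧ E (n / p))) {n : ℕ} (hn : 0 < n) :
    expansionWord p hp n ∈
        (chainDFA (fun a b : Fin p => P a b) (fun a : Fin p => E a)).accepts ↔ E n := by
  induction n using Nat.strong_induction_on with
  | _ n ih =>
    rw [expansionWord_eq_cons hp hn]
    -- The last letter read is the leading digit, itself a one-digit number, so `E` serves as the
    -- final condition.
    rcases Nat.eq_zero_or_pos (n / p) with h0 | hpos
    · rw [h0, expansionWord_zero, singleton_mem_chainDFA_accepts]
      have : n % p = n := Nat.mod_eq_of_lt ((Nat.div_eq_zero_iff_lt (by omega)).1 h0)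
      simp only [this]
    · rw [h n hpos, ← ih _ (Nat.div_lt_self hn hp) hpos, expansionWord_eq_cons hp hpos,
        cons_mem_chainDFA_accepts]

/-! ### Return to natural numbers -/

theorem weightedSum_one (m n : ℕ) :
    weightedSum n (1 : (Fin m → ℕ) → ℤ_[p]) = sumMultinomialNotDvd p m n := by
  simp [weightedSum, sumMultinomialNotDvd]

/-- The tuple (n, 0, …, 0) contributes 1. Positivity is needed since `padicValNat p 0` is 0. -/
theorem sumMultinomialNotDvd_pos {m : ℕ} (hm : 0 < m) (n : ℕ) :
    0 < sumMultinomialNotDvd p m n := by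
  have hp := (Fact.out : p.Prime)
  have h1 : Nat.multinomial univ (Pi.single ⟨0, hm⟩ n : Fin m → ℕ) = 1 := by
    have h2 := Nat.multinomial_spec univ (Pi.single ⟨0, hm⟩ n : Fin m → ℕ)
    have h3 : ∏ i, ((Pi.single ⟨0, hm⟩ n : Fin m → ℕ) i).factorial = n.factorial := by
      rw [prod_eq_single ⟨0, hm⟩] <;> simp +contextual
    rw [h3, sum_pi_single' ] at h2
    simpa [Nat.factorial_ne_zero] using h2
  refine lt_of_lt_of_le Nat.one_pos (h1.symm.le.trans ?_)
  refine single_le_sum (f := fun x => Nat.multinomial univ x) (fun _ _ => Nat.zero_le _) ?_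
  rw [mem_filter, h1, mem_piAntidiag]
  simp [hp.one_lt.ne']

theorem pow_dvd_natCast_iff {a : ℕ} (ha : a ≠ 0) (e : ℕ) :
    (p : ℤ_[p]) ^ e ∣ (a : ℤ_[p]) ↔ e ≤ padicValNat p a := by
  rw [← padicValNat_dvd_iff_le ha]
  have := PadicInt.pow_p_dvd_int_iff (p := p) e a
  rw [Int.cast_natCast] at this
  rw [this]
  exact_mod_cast Iff.rfl

end

theorem proposition4p7 (p k : ℕ) (hp : p.Prime) (hk : 0 < k) :
    (∀ n : ℕ, 0 < n →
      nonzeroDigitCount p n + padicValNat p k ≤ padicValNat p (sumMultinomialNotDvd p (k * p) n)) ∧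
    ∃ (σ : Type) (_ : Fintype σ) (F : DFA (Fin p) σ), ∀ n : ℕ, 0 < n →
      (padicValNat p (sumMultinomialNotDvd p (k * p) n) =
          nonzeroDigitCount p n + padicValNat p k ↔
        expansionWord p hp.one_lt n ∈ F.accepts) := by
  have : Fact p.Prime := ⟨hp⟩
  have hm : 0 < k * p := Nat.mul_pos hk hp.pos
  have : Nonempty (Fin (k * p)) := ⟨⟨0, hm⟩⟩
  have hA : ∀ n, sumMultinomialNotDvd p (k * p) n ≠ 0 := fun n =>
    (sumMultinomialNotDvd_pos hm n).ne'
  have hι : (p : ℤ_[p]) ^ (padicValNat p k + 1) ∣ (Fintype.card (Fin (k * p)) : ℤ_[p]) := by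
    rw [Fintype.card_fin, pow_dvd_natCast_iff hm.ne', padicValNat.mul hk.ne' hp.ne_zero,
      padicValNat_self]
  have hle : ∀ n : ℕ, 0 < n → nonzeroDigitCount p n + padicValNat p k ≤
      padicValNat p (sumMultinomialNotDvd p (k * p) n) := by
    intro n hn
    rw [← pow_dvd_natCast_iff (hA n), ← weightedSum_one]
    exact pow_dvd_weightedSum hι hn (one_mem _)
  refine ⟨hle, ?_⟩
  obtain ⟨P, hP⟩ := exists_pow_dvd_weightedSum_iff hι
  refine ⟨_, inferInstance, _, fun n hn => Iff.trans ?_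
    (mem_chainDFA_accepts_iff hp.one_lt _ P hP hn).symm⟩
  rw [weightedSum_one, pow_dvd_natCast_iff (hA n)]
  have := hle n hn
  omega
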